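/- Let $k,d$ be natural numbers and let $M\in C^\infty(\mathbb R^k,M_d(\mathbb R))$ be such that its symmetric part $M_s(x)=\tfrac12\,(M(x)+M(x)^t)$ is positive semidefinite for every $x\in\mathbb R^k$. Consider $\mathcal P=-\Delta\otimes I_d+M(x)$, $(\mathcal P u)(x)=-\Delta u(x)+M(x)u(x)$, as an unbounded operator in the real Hilbert space $L^2(\mathbb R^k,\mathbb R^d)$ with domain $C_0^\infty(\mathbb R^k,\mathbb R^d)$. Then $\mathcal P$ is closable and its closure $\mathbf P$ under the graph norm is maximally accretive, i.e. $\mathbf P$ is densely defined, $\langle \mathbf P u,u\rangle\ge 0$ for all $u\in D(\mathbf P)$, and $\mathbf P$ has no proper extension to an unbounded linear operator in $L^2(\mathbb R^k,\mathbb R^d)$ with the latter property. Moreover, $D(\mathbf P)\subset H^1(\mathbb R^k,\mathbb R^d)$. In particular, for every $\varepsilon>0$ and every $\mathbf b\in C^\infty(\mathbb R^3,\mathbb R^3)$, the Bloch–Torrey operator $u\mapsto-\varepsilon^2\Delta u+\mathbf b\times u$ in $L^2(\mathbb R^3,\mathbb R^3)$ with domain $C_0^\infty(\mathbb R^3,\mathbb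 R^3)$ is closable, and its closure is maximally accretive. -/

import Mathlib

open MeasureTheory
open scoped ContDiff Matrix

noncomputable section

namespace BlochTorrey

/-- The Euclidean space `ℝⁿ`. -/
abbrev E (n : ℕ) : Type := EuclideanSpace ℝ (Fin n)

/-- The real Hilbert space `L²(ℝᵏ, ℝᵈ)`. -/
abbrev L2 (k d : ℕ) : Type := Lp (E d) 2 (volume : Measure (E k))

/-- The space `C₀^∞(ℝᵏ, F)` of smooth compactly supported functions. -/
abbrev Test (k : ℕ) (F : Type) [NormedAddCommGroup F] [NormedSpace ℝ F] : Type :=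
  TestFunction (⊤ : TopologicalSpace.Opens (E k)) F (⊤ : ℕ∞)

/-! ### Accretive operators in a real Hilbert space -/

section Accretive

variable {H : Type*} [NormedAddCommGroup H] [InnerProductSpace ℝ H]

/-- An unbounded operator `T` is accretive if `⟨T u, u⟩ ≥ 0` on its domain. -/
def IsAccretive (T : H →ₗ.[ℝ] H) : Prop :=
  ∀ u : T.domain, 0 ≤ inner ℝ (T u) (u : H)

/-- A densely defined accretive operator is maximally accretive if it has no proper accretive
extension. -/
structure IsMaximallyAccretive (T : H →ₗ.[ℝ] H) : Prop where
  dense_domain : Dense (T.domain : Set H)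
  accretive : IsAccretive T
  maximal : ∀ S : H →ₗ.[ℝ] H, IsAccretive S → T ≤ S → S = T

end Accretive

/-! ### The space `H¹(ℝᵏ, ℝᵈ)` -/

/-- `u ∈ L²` belongs to `H¹` if each distributional partial derivative `∂ᵢ u` is a function
`g ∈ L²`, that is `∫ φ g = - ∫ (∂ᵢ φ) u` for all real test functions `φ`. -/
def MemH1 {k d : ℕ} (u : L2 k d) : Prop :=
  ∀ i : Fin k, ∃ g : L2 k d, ∀ φ : Test k ℝ,
    ∫ x, φ x • g x = - ∫ x, (fderiv ℝ φ x (EuclideanSpace.single i 1)) • u x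

/-! ### Operators in `L²` with domain `C₀^∞` -/

/-- The `L²` class of a test function. -/
def testToL2 (k d : ℕ) : Test k (E d) →ₗ[ℝ] L2 k d where
  toFun φ := (φ.continuous.memLp_of_hasCompactSupport φ.hasCompactSupport).toLp φ
  map_add' _ _ := rfl
  map_smul' _ _ := rfl

theorem testToL2_injective (k d : ℕ) : Function.Injective (testToL2 k d) := by
  intro φ ψ h
  have h' : (φ : E k → E d) =ᵐ[volume] ψ :=
    (MemLp.toLp_eq_toLp_iff (φ.continuous.memLp_of_hasCompactSupport φ.hasCompactSupport)
      (ψ.continuous.memLp_of_hasCompactSupport ψ.hasCompactSupport)).1 h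
  exact DFunLike.coe_injective (φ.continuous.ae_eq_iff_eq volume ψ.continuous |>.1 h')

/-- A linear map `A` of `C₀^∞(ℝᵏ, ℝᵈ)` into itself, regarded as an unbounded operator in
`L²(ℝᵏ, ℝᵈ)` with domain `C₀^∞(ℝᵏ, ℝᵈ)`. -/
def toUnbounded {k d : ℕ} (A : Test k (E d) →ₗ[ℝ] Test k (E d)) : L2 k d →ₗ.[ℝ] L2 k d where
  domain := LinearMap.range (testToL2 k d)
  toFun := testToL2 k d ∘ₗ A ∘ₗ
    (LinearEquiv.ofInjective (testToL2 k d) (testToL2_injective k d)).symm.toLinearMap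

theorem toUnbounded_apply {k d : ℕ} (A : Test k (E d) →ₗ[ℝ] Test k (E d)) (φ : Test k (E d)) :
    toUnbounded A ⟨testToL2 k d φ, LinearMap.mem_range_self _ φ⟩ = testToL2 k d (A φ) := by
  have : (LinearEquiv.ofInjective (testToL2 k d) (testToL2_injective k d)).symm
      ⟨testToL2 k d φ, LinearMap.mem_range_self _ φ⟩ = φ := by
    rw [LinearEquiv.symm_apply_eq]; rfl
  exact congrArg (fun ψ => testToL2 k d (A ψ)) this

/-! ### The differential operators on test functions -/

theorem two_le_infty : (2 : WithTop ℕ∞) ≤ ∞ :=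
  WithTop.coe_le_coe.2 (le_top : (2 : ℕ∞) ≤ ⊤)

open Laplacian in
/-- The Laplacian (acting on each component of) a test function. -/
def testLaplacian (k d : ℕ) : Test k (E d) →ₗ[ℝ] Test k (E d) where
  toFun φ :=
    { toFun := Δ (φ : E k → E d)
      contDiff' := by
        rw [InnerProductSpace.laplacian_eq_iteratedFDeriv_stdOrthonormalBasis]
        refine ContDiff.sum fun i _ => ?_
        have h : ContDiff ℝ ∞ (iteratedFDeriv ℝ 2 (φ : E k → E d)) :=
          φ.contDiff.iteratedFDeriv_right (by rfl)
        exact (ContinuousMultilinearMap.apply ℝ (fun _ : Fin 2 => E k) (E d)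
          ![(stdOrthonormalBasis ℝ (E k)) i, (stdOrthonormalBasis ℝ (E k)) i]).contDiff.comp h
      hasCompactSupport' := by
        refine φ.hasCompactSupport.mono' fun x hx => ?_
        by_contra hx'
        refine hx ?_
        have h : (φ : E k → E d) =ᶠ[nhds x] fun _ => (0 : E d) :=
          notMem_tsupport_iff_eventuallyEq.1 hx'
        rw [(InnerProductSpace.laplacian_congr_nhds h).eq_of_nhds,
          InnerProductSpace.laplacian_const]
        rfl
      tsupport_subset' := fun _ _ => trivial }
  map_add' φ ψ := by
    ext1 x
    exact ContDiffAt.laplacian_add (φ.contDiff.contDiffAt.of_le two_le_infty)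
      (ψ.contDiff.contDiffAt.of_le two_le_infty)
  map_smul' c φ := by
    ext1 x
    exact InnerProductSpace.laplacian_smul c
      (φ.contDiff.contDiffAt.of_le two_le_infty)

/-- Pointwise multiplication `φ ↦ M φ`, `(M φ)(x) = M(x) φ(x)`, by a smooth matrix-valued
function. -/
def testMulVec {k d : ℕ} (M : E k → Matrix (Fin d) (Fin d) ℝ)
    (hM : ∀ i j, ContDiff ℝ ∞ fun x => M x i j) : Test k (E d) →ₗ[ℝ] Test k (E d) where
  toFun φ :=
    { toFun := fun x => WithLp.toLp 2 (M x *ᵥ (φ x).ofLp)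
      contDiff' := by
        refine contDiff_euclidean.2 fun i => ?_
        change ContDiff ℝ ∞ fun x => ∑ j, M x i j * φ x j
        exact ContDiff.sum fun j _ => (hM i j).mul (contDiff_euclidean.1 φ.contDiff j)
      hasCompactSupport' := by
        refine φ.hasCompactSupport.mono fun x hx hx' => hx ?_
        simp [hx']
      tsupport_subset' := fun _ _ => trivial }
  map_add' φ ψ := by
    ext1 x
    change WithLp.toLp 2 (M x *ᵥ ((φ x).ofLp + (ψ x).ofLp)) = _
    rw [Matrix.mulVec_add]; rfl
  map_smul' c φ := by
    ext1 x
    change WithLp.toLp 2 (M x *ᵥ (c • (φ x).ofLp)) = _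
    rw [Matrix.mulVec_smul]; rfl

/-- Pointwise cross product `φ ↦ b × φ`, `(b × φ)(x) = b(x) × φ(x)`, with a smooth vector field
on `ℝ³`. -/
def testCross (b : E 3 → E 3) (hb : ContDiff ℝ ∞ b) : Test 3 (E 3) →ₗ[ℝ] Test 3 (E 3) where
  toFun φ :=
    { toFun := fun x => WithLp.toLp 2 ((b x).ofLp ⨯₃ (φ x).ofLp)
      contDiff' := by
        have h₁ := contDiff_euclidean.1 hb
        have h₂ := contDiff_euclidean.1 φ.contDiff
        refine contDiff_euclidean.2 fun i => ?_
        fin_cases i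
        · exact ((h₁ 1).mul (h₂ 2)).sub ((h₁ 2).mul (h₂ 1))
        · exact ((h₁ 2).mul (h₂ 0)).sub ((h₁ 0).mul (h₂ 2))
        · exact ((h₁ 0).mul (h₂ 1)).sub ((h₁ 1).mul (h₂ 0))
      hasCompactSupport' := by
        refine φ.hasCompactSupport.mono fun x hx hx' => hx ?_
        simp [hx']
      tsupport_subset' := fun _ _ => trivial }
  map_add' φ ψ := by
    ext1 x
    change WithLp.toLp 2 ((b x).ofLp ⨯₃ ((φ x).ofLp + (ψ x).ofLp)) = _
    rw [map_add]; rfl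
  map_smul' c φ := by
    ext1 x
    change WithLp.toLp 2 ((b x).ofLp ⨯₃ (c • (φ x).ofLp)) = _
    rw [map_smul]; rfl

/-- The operator `-Δ ⊗ I_d + M(x)` in `L²(ℝᵏ, ℝᵈ)` with domain `C₀^∞(ℝᵏ, ℝᵈ)`. -/
def schrodingerOp {k d : ℕ} (M : E k → Matrix (Fin d) (Fin d) ℝ)
    (hM : ∀ i j, ContDiff ℝ ∞ fun x => M x i j) : L2 k d →ₗ.[ℝ] L2 k d :=
  toUnbounded (-testLaplacian k d + testMulVec M hM)

/-- The Bloch–Torrey operator `-ε² Δ + b ×` in `L²(ℝ³, ℝ³)` with domain `C₀^∞(ℝ³, ℝ³)`. -/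
def blochTorreyOp (ε : ℝ) (b : E 3 → E 3) (hb : ContDiff ℝ ∞ b) : L2 3 3 →ₗ.[ℝ] L2 3 3 :=
  toUnbounded (-(ε ^ 2 • testLaplacian 3 3) + testCross b hb)

end BlochTorrey

end

noncomputable section

namespace BlochTorrey

/-! ### Accretive operators in a real Hilbert space. -/

section AccretiveClosure

open Filter Topology

variable {H : Type*} [NormedAddCommGroup H] [InnerProductSpace ℝ H]

/-! A densely defined accretive operator is closable, and its closure is maximally accretive once `1
+ T` has dense range: then `1 + T.closure` is onto, while `1 + S` is injective for every accretive
`S`, so no proper accretive extension exists.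

Dense range is a uniqueness statement: a vector `v ∈ L²` orthogonal to the range solves `v - cΔv +
Nᵗv = 0` weakly, and `IsWeakSolution.eq_zero` shows `v = 0`. Formally, pair the equation with `χv`
for a cutoff `χ ≥ 0`. Since `⟨v, Nᵗv⟩ ≥ 0` and `2⟨v, Δv⟩ ≤ Δ|v|²`, this yields `∫ χ|v|² ≤ (c/2) ∫ Δχ
|v|²`, and for `χ(r·)` the right side is `O(r²)`. No growth bound on `N` is needed because `N`
enters only on the support of `χ`. Mollification makes this rigorous without elliptic regularity
(`IsWeakSolution.integral_cutoff_le`).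

The `H¹` bound comes from `c ∑ ‖∂ᵢφ‖² ≤ ⟨Aφ, φ⟩`, which makes gradients converge along
graph-convergent sequences. -/

theorem IsAccretive.inner_nonneg_of_mem_closure_graph {T : H →ₗ.[ℝ] H} (hT : IsAccretive T)
    {p : H × H} (hp : p ∈ T.graph.topologicalClosure) : 0 ≤ inner ℝ p.2 p.1 := by
  have hclosed : IsClosed {q : H × H | 0 ≤ inner ℝ q.2 q.1} :=
    isClosed_le continuous_const (continuous_snd.inner continuous_fst)
  refine closure_minimal (fun q hq => ?_) hclosed hp
  obtain ⟨y, h₁, h₂⟩ := LinearPMap.mem_graph_iff (f := T) |>.1 hq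
  simpa [← h₁, ← h₂] using hT y

/-- Perturbing `(0, y)` by `t(w, Tw)` gives `t⟨y, w⟩ + t²⟨Tw, w⟩ ≥ 0` for all real `t`, so the
linear coefficient vanishes; density of the `w` finishes. -/
theorem IsAccretive.snd_eq_zero_of_mem_closure_graph {T : H →ₗ.[ℝ] H} (hT : IsAccretive T)
    (hd : Dense (T.domain : Set H)) {y : H} (hy : ((0 : H), y) ∈ T.graph.topologicalClosure) :
    y = 0 := by
  refine hd.eq_zero_of_inner_left ℝ fun w₀ hw₀ => ?_
  obtain ⟨w, rfl⟩ : ∃ w : T.domain, (w : H) = w₀ := ⟨⟨w₀, hw₀⟩, rfl⟩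
  have hw : ((w : H), T w) ∈ T.graph.topologicalClosure :=
    T.graph.le_topologicalClosure (T.mem_graph w)
  have key (t : ℝ) : 0 ≤ t * inner ℝ y (w : H) + t ^ 2 * inner ℝ (T w) (w : H) := by
    have h := hT.inner_nonneg_of_mem_closure_graph (add_mem hy (Submodule.smul_mem _ t hw))
    simp only [Prod.smul_mk, Prod.mk_add_mk, zero_add, inner_add_left, real_inner_smul_left,
      real_inner_smul_right] at h
    linarith
  generalize inner ℝ y (w : H) = a at key
  generalize inner ℝ (T w) (w : H) = b at key
  by_contra ha
  replace ha : a ≠ 0 := ha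
  have hb : 0 ≤ b := by nlinarith [key 1, key (-1)]
  have hb1 : 0 < b + 1 := by linarith
  -- With `b + 1` in place of `b` the choice also makes sense when `b = 0`; the form takes the value
  -- `-a²/(b+1)²`.
  have h := key (-a / (b + 1))
  have : -a / (b + 1) * a + (-a / (b + 1)) ^ 2 * b = -a ^ 2 / (b + 1) ^ 2 := by
    field_simp
    ring
  rw [this, neg_div] at h
  have : 0 < a ^ 2 / (b + 1) ^ 2 := by positivity
  linarith

theorem IsAccretive.isClosable {T : H →ₗ.[ℝ] H} (hT : IsAccretive T)
    (hd : Dense (T.domain : Set H)) : T.IsClosable := by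
  refine ⟨T.graph.topologicalClosure.toLinearPMap, ?_⟩
  refine (Submodule.toLinearPMap_graph_eq _ fun x hx hx0 => ?_).symm
  obtain ⟨a, b⟩ := x
  obtain rfl : a = 0 := hx0
  exact hT.snd_eq_zero_of_mem_closure_graph hd hx

theorem IsAccretive.closure {T : H →ₗ.[ℝ] H} (hT : IsAccretive T)
    (hd : Dense (T.domain : Set H)) : IsAccretive T.closure := fun u => by
  have h := T.closure.mem_graph u
  rw [← (hT.isClosable hd).graph_closure_eq_closure_graph] at h
  exact hT.inner_nonneg_of_mem_closure_graph h

/-- Pair `u + Tu` with `u`. Thus `1 + T` is injective with inverse of norm at most one, which serves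
both surjectivity and maximality. -/
theorem IsAccretive.norm_le_norm_add {T : H →ₗ.[ℝ] H} (hT : IsAccretive T) (u : T.domain) :
    ‖(u : H)‖ ≤ ‖(u : H) + T u‖ := by
  have h : ‖(u : H)‖ * ‖(u : H)‖ ≤ ‖(u : H) + T u‖ * ‖(u : H)‖ := by
    refine le_trans ?_ (real_inner_le_norm _ _)
    rw [inner_add_left, real_inner_self_eq_norm_mul_norm]
    linarith [hT u]
  rcases (norm_nonneg (u : H)).eq_or_lt with h0 | h0
  · rw [← h0]; positivity
  · exact le_of_mul_le_mul_right h h0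

/-- `hr` says that `1 + T` has dense range; by the lower bound, convergence of `uₙ + Tuₙ` makes `uₙ`
Cauchy, so the limit lies in the graph of the closure. -/
theorem IsAccretive.exists_closure_add_eq [CompleteSpace H] {T : H →ₗ.[ℝ] H}
    (hT : IsAccretive T) (hd : Dense (T.domain : Set H))
    (hr : ∀ v : H, (∀ u : T.domain, inner ℝ v ((u : H) + T u) = 0) → v = 0) (f : H) :
    ∃ u : T.closure.domain, (u : H) + T.closure u = f := by
  let R : T.domain →ₗ[ℝ] H := T.domain.subtype + T.toFun
  have hR : (LinearMap.range R).topologicalClosure = ⊤ := by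
    rw [Submodule.topologicalClosure_eq_top_iff, Submodule.eq_bot_iff]
    intro v hv
    refine hr v fun u => ?_
    rw [real_inner_comm]
    exact (Submodule.mem_orthogonal _ _).1 hv _ ⟨u, rfl⟩
  have hf : f ∈ _root_.closure (LinearMap.range R : Set H) := by
    rw [← Submodule.topologicalClosure_coe, hR]; trivial
  obtain ⟨s, hs, hsf⟩ := mem_closure_iff_seq_limit.1 hf
  choose u hu using hs
  have hsub (m n : ℕ) : dist (u m : H) (u n) ≤ dist (s m) (s n) := by
    have h := hT.norm_le_norm_add (u m - u n)
    rw [dist_eq_norm, dist_eq_norm, ← hu, ← hu, ← map_sub]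
    exact h
  have hcau : CauchySeq fun n => (u n : H) := by
    rw [Metric.cauchySeq_iff]
    intro ε hε
    obtain ⟨N, hN⟩ := Metric.cauchySeq_iff.1 hsf.cauchySeq ε hε
    exact ⟨N, fun m hm n hn => (hsub m n).trans_lt (hN m hm n hn)⟩
  obtain ⟨w, hw⟩ := cauchySeq_tendsto_of_complete hcau
  have hTu : Tendsto (fun n => T (u n)) atTop (𝓝 (f - w)) := by
    refine (hsf.sub hw).congr fun n => ?_
    rw [← hu]
    exact add_sub_cancel_left _ _
  have hmem : (w, f - w) ∈ T.closure.graph := by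
    rw [← (hT.isClosable hd).graph_closure_eq_closure_graph]
    exact mem_closure_of_tendsto (hw.prodMk_nhds hTu) (Eventually.of_forall fun n => T.mem_graph _)
  obtain ⟨y, h₁, h₂⟩ := LinearPMap.mem_graph_iff (f := T.closure) |>.1 hmem
  refine ⟨y, ?_⟩
  simp only at h₁ h₂
  rw [h₁, h₂, add_sub_cancel]

/-- A densely defined accretive operator `T` such that `1 + T` has dense range has a maximally
accretive closure. -/
theorem IsAccretive.isMaximallyAccretive_closure [CompleteSpace H] {T : H →ₗ.[ℝ] H}
    (hT : IsAccretive T) (hd : Dense (T.domain : Set H))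
    (hr : ∀ v : H, (∀ u : T.domain, inner ℝ v ((u : H) + T u) = 0) → v = 0) :
    IsMaximallyAccretive T.closure where
  dense_domain := hd.mono T.le_closure.1
  accretive := hT.closure hd
  maximal S hS hle := by
    refine le_antisymm ?_ hle
    refine LinearPMap.le_of_le_graph fun p hp => ?_
    obtain ⟨u, h₁, h₂⟩ := LinearPMap.mem_graph_iff (f := S) |>.1 hp
    -- Surjectivity of `1 + T.closure` gives `w` with the same image as `u` under `1 + S`;
    -- injectivity of `1 + S` then forces `w = u`.
    obtain ⟨w, hw⟩ := hT.exists_closure_add_eq hd hr ((u : H) + S u)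
    let w' : S.domain := ⟨w, hle.1 w.2⟩
    have hw' : S w' = T.closure w := (hle.2 (x := w) (y := w') rfl).symm
    have h0 := hS.norm_le_norm_add (w' - u)
    have hz : ((w' - u : S.domain) : H) + S (w' - u) = 0 := by
      rw [LinearPMap.map_sub, hw']
      push_cast
      change ((w : H) - u) + _ = 0
      rw [← sub_eq_zero.2 hw]
      abel
    rw [hz, norm_zero, norm_le_zero_iff, Submodule.coe_sub, sub_eq_zero] at h0
    have hwu : w' = u := Subtype.ext h0
    have : p = ((w : H), T.closure w) := by
      ext
      · exact h₁.symm.trans h0.symm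
      · rw [← h₂, ← hwu, hw']
    rw [this]
    exact T.closure.mem_graph w

end AccretiveClosure

/-! ### Partial derivatives, Green's formulas, and derivatives of convolutions. -/

section Calculus

open Laplacian ContinuousLinearMap Convolution

variable {k : ℕ} {F G W : Type*} [NormedAddCommGroup F] [NormedSpace ℝ F]
  [NormedAddCommGroup G] [NormedSpace ℝ G] [NormedAddCommGroup W] [NormedSpace ℝ W]

/-- The partial derivative `∂ᵢ g`. -/
def pderiv (i : Fin k) (g : E k → F) : E k → F := fun x => fderiv ℝ g x (EuclideanSpace.single i 1)

theorem contDiff_pderiv {g : E k → F} (hg : ContDiff ℝ ∞ g) (i : Fin k) :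
    ContDiff ℝ ∞ (pderiv i g) :=
  (hg.fderiv_right (m := ∞) (by rfl)).clm_apply contDiff_const

theorem hasCompactSupport_pderiv {g : E k → F} (hg : HasCompactSupport g) (i : Fin k) :
    HasCompactSupport (pderiv i g) :=
  hg.fderiv_apply ℝ _

theorem pderiv_eq {g : E k → F} {g' : E k →L[ℝ] F} {x : E k} (h : HasFDerivAt g g' x)
    (i : Fin k) : pderiv i g x = g' (EuclideanSpace.single i 1) := by
  rw [pderiv, h.fderiv]

theorem hasFDerivAt_of_contDiff {g : E k → F} (hg : ContDiff ℝ ∞ g) (x : E k) :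
    HasFDerivAt g (fderiv ℝ g x) x :=
  (hg.differentiable (by simp) x).hasFDerivAt

theorem laplacian_eq_sum_pderiv {g : E k → F} (hg : ContDiff ℝ ∞ g) :
    Δ g = fun x => ∑ i, pderiv i (pderiv i g) x := by
  rw [InnerProductSpace.laplacian_eq_iteratedFDeriv_orthonormalBasis g
    (EuclideanSpace.basisFun (Fin k) ℝ)]
  ext x
  refine Finset.sum_congr rfl fun i _ => ?_
  have h := ((hg.fderiv_right (m := ∞) (by rfl)).differentiable (by simp) x).hasFDerivAt.clm_apply
    (hasFDerivAt_const (EuclideanSpace.single i (1 : ℝ)) x)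
  have h' : pderiv i (pderiv i g) x = _ := pderiv_eq h i
  rw [h', iteratedFDeriv_two_apply]
  simp

theorem contDiff_laplacian {g : E k → F} (hg : ContDiff ℝ ∞ g) : ContDiff ℝ ∞ (Δ g) := by
  rw [laplacian_eq_sum_pderiv hg]
  exact ContDiff.sum fun i _ => contDiff_pderiv (contDiff_pderiv hg i) i

theorem hasCompactSupport_laplacian {g : E k → F} (hg : ContDiff ℝ ∞ g)
    (hc : HasCompactSupport g) : HasCompactSupport (Δ g) := by
  refine HasCompactSupport.intro hc fun x hx => ?_
  rw [laplacian_eq_sum_pderiv hg]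
  refine Finset.sum_eq_zero fun i _ => ?_
  refine image_eq_zero_of_notMem_tsupport fun h => hx ?_
  exact tsupport_fderiv_apply_subset ℝ _ (tsupport_fderiv_apply_subset ℝ _ h)

theorem integrable_bilin {f : E k → F} {g : E k → G} (hf : Continuous f) (hg : Continuous g)
    (hc : HasCompactSupport f) (B : F →L[ℝ] G →L[ℝ] W) : Integrable fun x => B (f x) (g x) := by
  refine Continuous.integrable_of_hasCompactSupport (by fun_prop) (hc.mono' ?_)
  intro x hx
  refine subset_tsupport _ fun h => hx ?_
  simp [h]

/-- Compact support of `f` alone makes all three products integrable. A general `B` covers both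
multiplication of scalars and the inner product. -/
theorem integral_bilin_pderiv {f : E k → F} {g : E k → G} (hf : ContDiff ℝ ∞ f)
    (hg : ContDiff ℝ ∞ g) (hc : HasCompactSupport f) (B : F →L[ℝ] G →L[ℝ] W) (i : Fin k) :
    ∫ x, B (f x) (pderiv i g x) = - ∫ x, B (pderiv i f x) (g x) :=
  integral_bilinear_fderiv_right_eq_neg_left_of_integrable (B := B)
    (integrable_bilin (contDiff_pderiv hf i).continuous hg.continuous
      (hasCompactSupport_pderiv hc i) B)
    (integrable_bilin hf.continuous (contDiff_pderiv hg i).continuous hc B)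
    (integrable_bilin hf.continuous hg.continuous hc B)
    (fun _ _ => hf.differentiable (by simp) _) (fun _ _ => hg.differentiable (by simp) _)

theorem integral_bilin_laplacian_eq_neg_sum {f : E k → F} {g : E k → G} (hf : ContDiff ℝ ∞ f)
    (hg : ContDiff ℝ ∞ g) (hc : HasCompactSupport f) (B : F →L[ℝ] G →L[ℝ] W) :
    ∫ x, B (f x) (Δ g x) = - ∑ i, ∫ x, B (pderiv i f x) (pderiv i g x) := by
  simp_rw [laplacian_eq_sum_pderiv hg, map_sum]
  rw [integral_finsetSum _ fun i _ => integrable_bilin hf.continuous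
    (contDiff_pderiv (contDiff_pderiv hg i) i).continuous hc B, ← Finset.sum_neg_distrib]
  exact Finset.sum_congr rfl fun i _ => integral_bilin_pderiv hf (contDiff_pderiv hg i) hc B i

theorem integral_bilin_laplacian {f : E k → F} {g : E k → G} (hf : ContDiff ℝ ∞ f)
    (hg : ContDiff ℝ ∞ g) (hc : HasCompactSupport f) (B : F →L[ℝ] G →L[ℝ] W) :
    ∫ x, B (f x) (Δ g x) = ∫ x, B (Δ f x) (g x) := by
  rw [integral_bilin_laplacian_eq_neg_sum hf hg hc]
  simp_rw [laplacian_eq_sum_pderiv hf, map_sum, _root_.sum_apply]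
  rw [integral_finsetSum _ fun i _ => integrable_bilin
    (contDiff_pderiv (contDiff_pderiv hf i) i).continuous hg.continuous
    (hasCompactSupport_pderiv (hasCompactSupport_pderiv hc i) i) B, ← Finset.sum_neg_distrib]
  refine Finset.sum_congr rfl fun i _ => ?_
  rw [integral_bilin_pderiv (contDiff_pderiv hf i) hg (hasCompactSupport_pderiv hc i) B i, neg_neg]

theorem pderiv_comp_sub_smul {ρ : E k → ℝ} (hρ : ContDiff ℝ ∞ ρ) (i : Fin k) (x : E k) (a : F) :
    pderiv i (fun y => ρ (x - y) • a) = fun y => pderiv i ρ (x - y) • -a := by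
  ext y
  have h := ((hasFDerivAt_of_contDiff hρ (x - y)).comp y
    ((hasFDerivAt_id y).const_sub x)).smul_const a
  refine (pderiv_eq h i).trans ?_
  simp [pderiv]

theorem laplacian_comp_sub_smul {ρ : E k → ℝ} (hρ : ContDiff ℝ ∞ ρ) (x : E k) (a : F) :
    Δ (fun y => ρ (x - y) • a) = fun y => Δ ρ (x - y) • a := by
  have h : ContDiff ℝ ∞ fun y => ρ (x - y) • a :=
    (hρ.comp (contDiff_const.sub contDiff_id)).smul contDiff_const
  rw [laplacian_eq_sum_pderiv h, laplacian_eq_sum_pderiv hρ]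
  ext y
  simp_rw [pderiv_comp_sub_smul hρ, pderiv_comp_sub_smul (contDiff_pderiv hρ _), neg_neg,
    Finset.sum_smul]

theorem pderiv_comp_const_smul {g : E k → F} (hg : ContDiff ℝ ∞ g) (r : ℝ) (i : Fin k) :
    pderiv i (fun x => g (r • x)) = fun x => r • pderiv i g (r • x) := by
  ext x
  have h := (hasFDerivAt_of_contDiff hg (r • x)).comp x ((hasFDerivAt_id x).const_smul r)
  refine (pderiv_eq h i).trans ?_
  simp [pderiv]

theorem pderiv_const_smul {g : E k → F} (hg : ContDiff ℝ ∞ g) (r : ℝ) (i : Fin k) :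
    pderiv i (fun x => r • g x) = fun x => r • pderiv i g x := by
  ext x
  exact (pderiv_eq ((hasFDerivAt_of_contDiff hg x).const_smul r) i).trans rfl

theorem laplacian_comp_const_smul {g : E k → F} (hg : ContDiff ℝ ∞ g) (r : ℝ) :
    Δ (fun x => g (r • x)) = fun x => r ^ 2 • Δ g (r • x) := by
  have hs {f : E k → F} (hf : ContDiff ℝ ∞ f) : ContDiff ℝ ∞ fun x => f (r • x) :=
    hf.comp (contDiff_id.const_smul r)
  rw [laplacian_eq_sum_pderiv (hs hg), laplacian_eq_sum_pderiv hg]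
  ext x
  simp_rw [pderiv_comp_const_smul hg, pderiv_const_smul (hs (contDiff_pderiv hg _)),
    pderiv_comp_const_smul (contDiff_pderiv hg _), smul_smul, ← Finset.smul_sum, sq]

theorem pderiv_convolution {ρ : E k → ℝ} (hρ : ContDiff ℝ ∞ ρ) (hc : HasCompactSupport ρ)
    {v : E k → F} (hv : LocallyIntegrable v) (i : Fin k) :
    pderiv i (ρ ⋆[lsmul ℝ ℝ] v : E k → F) = (pderiv i ρ ⋆[lsmul ℝ ℝ] v : E k → F) := by
  ext x
  rw [pderiv_eq (hc.hasFDerivAt_convolution_left (lsmul ℝ ℝ) (hρ.of_le (by simp)) hv x) i,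
    convolution_def, ContinuousLinearMap.integral_apply]
  · rfl
  · exact (hc.fderiv ℝ).convolutionExists_left _ (hρ.continuous_fderiv (by simp)) hv x

theorem contDiff_convolution {ρ : E k → ℝ} (hρ : ContDiff ℝ ∞ ρ) (hc : HasCompactSupport ρ)
    {v : E k → F} (hv : LocallyIntegrable v) :
    ContDiff ℝ ∞ (ρ ⋆[lsmul ℝ ℝ] v : E k → F) :=
  hc.contDiff_convolution_left (lsmul ℝ ℝ) hρ hv

theorem integrable_convolution_integrand {ρ : E k → ℝ} (hρ : Continuous ρ)
    (hc : HasCompactSupport ρ) {v : E k → F} (hv : LocallyIntegrable v) (x : E k) :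
    Integrable fun y => ρ (x - y) • v y :=
  (hc.convolutionExists_left (lsmul ℝ ℝ) hρ hv x).integrable_swap

theorem laplacian_convolution {ρ : E k → ℝ} (hρ : ContDiff ℝ ∞ ρ) (hc : HasCompactSupport ρ)
    {v : E k → F} (hv : LocallyIntegrable v) (x : E k) :
    Δ (ρ ⋆[lsmul ℝ ℝ] v : E k → F) x = ∫ y, Δ ρ (x - y) • v y := by
  rw [laplacian_eq_sum_pderiv (contDiff_convolution hρ hc hv), laplacian_eq_sum_pderiv hρ]
  have h (i : Fin k) : pderiv i (pderiv i (ρ ⋆[lsmul ℝ ℝ] v : E k → F)) x =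
      ∫ y, pderiv i (pderiv i ρ) (x - y) • v y := by
    rw [pderiv_convolution hρ hc hv, pderiv_convolution (contDiff_pderiv hρ i)
      (hasCompactSupport_pderiv hc i) hv, convolution_lsmul_swap]
  simp_rw [h, Finset.sum_smul]
  rw [integral_finsetSum _ fun i _ => ?_]
  exact integrable_convolution_integrand (contDiff_pderiv (contDiff_pderiv hρ i) i).continuous
    (hasCompactSupport_pderiv (hasCompactSupport_pderiv hc i) i) hv x

end Calculus

/-! ### The Laplacian of `|w|²`. -/

section CalculusInner

open Laplacian

variable {k : ℕ} {F : Type*} [NormedAddCommGroup F] [InnerProductSpace ℝ F]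

theorem pderiv_inner {f g : E k → F} (hf : ContDiff ℝ ∞ f) (hg : ContDiff ℝ ∞ g) (i : Fin k) :
    pderiv i (fun x => inner ℝ (f x) (g x)) =
      fun x => inner ℝ (f x) (pderiv i g x) + inner ℝ (pderiv i f x) (g x) := by
  ext x
  exact fderiv_inner_apply ℝ (hf.differentiable (by simp) x) (hg.differentiable (by simp) x) _

/-- `Δ|w|² = 2⟨w, Δw⟩ + 2 ∑ |∂ᵢw|²`, and the gradient term is dropped. -/
theorem two_mul_inner_laplacian_le {w : E k → F} (hw : ContDiff ℝ ∞ w) (x : E k) :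
    2 * inner ℝ (w x) (Δ w x) ≤ Δ (fun x => inner ℝ (w x) (w x)) x := by
  rw [laplacian_eq_sum_pderiv hw, laplacian_eq_sum_pderiv (hw.inner ℝ hw)]
  simp only [inner_sum, Finset.mul_sum]
  refine Finset.sum_le_sum fun i _ => ?_
  have hd := contDiff_pderiv hw i
  have h : pderiv i (fun x => inner ℝ (w x) (w x)) =
      fun x => inner ℝ ((2 : ℝ) • w x) (pderiv i w x) := by
    rw [pderiv_inner hw hw]
    ext y
    rw [real_inner_comm (w y) (pderiv i w y), inner_smul_left]
    simp [two_mul]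
  have h2 : pderiv i (fun x => (2 : ℝ) • w x) = fun x => (2 : ℝ) • pderiv i w x :=
    pderiv_const_smul hw 2 i
  rw [h, pderiv_inner (hw.const_smul 2) hd, h2]
  simp only [real_inner_smul_left]
  linarith [real_inner_self_nonneg (x := pderiv i w x)]

end CalculusInner

/-! ### Mollification in `L²`. -/

section Mollifier

open ContinuousLinearMap Convolution Filter Topology
open scoped ENNReal NNReal

variable {k : ℕ} {F : Type*} [NormedAddCommGroup F]

theorem tendsto_eLpNorm_translate_sub (v : Lp F 2 (volume : Measure (E k))) :
    Tendsto (fun y : E k => eLpNorm (fun x => v (x - y) - v x) 2 volume) (𝓝 0) (𝓝 0) := by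
  let g : E k → C(E k, E k) := fun y => ⟨fun x => x - y, by fun_prop⟩
  have hg : Continuous g :=
    ContinuousMap.continuous_of_continuous_uncurry g (by
      change Continuous fun p : E k × E k => p.2 - p.1
      fun_prop)
  have hm (y : E k) : MeasurePreserving (g y) volume volume :=
    measurePreserving_sub_right volume y
  have h := ((continuous_const (y := v)).compMeasurePreservingLp hg hm (by simp)).tendsto 0
  have h0 : Lp.compMeasurePreserving (g 0) (hm 0) v = v := by
    refine Lp.ext ((Lp.coeFn_compMeasurePreserving v (hm 0)).trans ?_)
    refine Eventually.of_forall fun x => ?_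
    simp [g]
  rw [h0, Lp.tendsto_Lp_iff_tendsto_eLpNorm'] at h
  refine h.congr fun y => eLpNorm_congr_ae ?_
  filter_upwards [Lp.coeFn_compMeasurePreserving v (hm y)] with x hx
  simp only [Pi.sub_apply, hx]
  rfl

theorem eLpNorm_two_sq {α : Type*} [MeasurableSpace α] {μ : Measure α} (f : α → F) :
    eLpNorm f 2 μ ^ (2 : ℝ) = ∫⁻ x, ‖f x‖ₑ ^ (2 : ℝ) ∂μ :=
  eLpNorm_nnreal_pow_eq_lintegral (p := 2) two_ne_zero

theorem locallyIntegrable_coe_Lp (v : Lp F 2 (volume : Measure (E k))) :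
    LocallyIntegrable v :=
  (Lp.memLp v).locallyIntegrable (by norm_num)

variable [NormedSpace ℝ F]

/-- `ρ ⋆ v - v` is the average of the translation differences against the probability measure `ρ
dy`; Jensen's inequality for the square, then Tonelli. -/
theorem eLpNorm_convolution_sub_le [CompleteSpace F] {ρ : E k → ℝ} (hρ : Continuous ρ)
    (hc : HasCompactSupport ρ)
    (h0 : ∀ y, 0 ≤ ρ y) (h1 : ∫ y, ρ y = 1) {v : E k → F} (hv : StronglyMeasurable v)
    (hl : LocallyIntegrable v) {δ : ℝ≥0∞}
    (h : ∀ y, ρ y ≠ 0 → eLpNorm (fun x => v (x - y) - v x) 2 volume ≤ δ) :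
    eLpNorm (fun x => (ρ ⋆[lsmul ℝ ℝ] v : E k → F) x - v x) 2 volume ≤ δ := by
  have hρm : Measurable fun y => ENNReal.ofReal (ρ y) := hρ.measurable.ennreal_ofReal
  have hρi : Integrable ρ := hρ.integrable_of_hasCompactSupport hc
  set μ : Measure (E k) := volume.withDensity fun y => ENNReal.ofReal (ρ y) with hμ
  have : IsProbabilityMeasure μ := ⟨by
    rw [hμ, withDensity_apply _ MeasurableSet.univ, Measure.restrict_univ,
      ← ofReal_integral_eq_lintegral_ofReal hρi (Eventually.of_forall h0), h1, ENNReal.ofReal_one]⟩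
  have hgm : StronglyMeasurable fun p : E k × E k => v (p.1 - p.2) - v p.1 :=
    (hv.comp_measurable (measurable_fst.sub measurable_snd)).sub (hv.comp_measurable measurable_fst)
  have hx (x : E k) : ‖(ρ ⋆[lsmul ℝ ℝ] v : E k → F) x - v x‖ₑ ^ (2 : ℝ) ≤
      ∫⁻ y, ‖v (x - y) - v x‖ₑ ^ (2 : ℝ) ∂μ := by
    have hgx : StronglyMeasurable fun y => v (x - y) - v x :=
      hgm.comp_measurable measurable_prodMk_left
    rw [← eLpNorm_two_sq]
    refine ENNReal.rpow_le_rpow ?_ (by norm_num)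
    -- Jensen's inequality, in the form `L¹ ≤ L²` for a probability measure.
    refine le_trans ?_ (eLpNorm_le_eLpNorm_of_exponent_le (p := 1) (by norm_num)
      hgx.aestronglyMeasurable)
    have e : (ρ ⋆[lsmul ℝ ℝ] v : E k → F) x - v x = ∫ y, ρ y • (v (x - y) - v x) := by
      simp_rw [smul_sub]
      have hi : Integrable fun y => ρ y • v (x - y) :=
        hc.convolutionExists_left (lsmul ℝ ℝ) hρ hl x
      rw [integral_sub hi (hρi.smul_const _), integral_smul_const, h1, one_smul]
      rfl
    rw [e, eLpNorm_one_eq_lintegral_enorm, hμ, lintegral_withDensity_eq_lintegral_mul _ hρm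
      hgx.enorm]
    refine (enorm_integral_le_lintegral_enorm _).trans_eq (lintegral_congr fun y => ?_)
    rw [enorm_smul, Real.enorm_of_nonneg (h0 y)]
    rfl
  rw [← ENNReal.rpow_le_rpow_iff (z := 2) (by norm_num), eLpNorm_two_sq]
  calc ∫⁻ x, ‖(ρ ⋆[lsmul ℝ ℝ] v : E k → F) x - v x‖ₑ ^ (2 : ℝ)
      ≤ ∫⁻ x, ∫⁻ y, ‖v (x - y) - v x‖ₑ ^ (2 : ℝ) ∂μ := lintegral_mono hx
    _ = ∫⁻ y, (∫⁻ x, ‖v (x - y) - v x‖ₑ ^ (2 : ℝ)) ∂μ :=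
        lintegral_lintegral_swap (hgm.enorm.pow_const 2).aemeasurable
    _ ≤ ∫⁻ _, δ ^ (2 : ℝ) ∂μ := by
        refine lintegral_mono_ae ?_
        rw [hμ, ae_withDensity_iff hρm]
        refine Eventually.of_forall fun y hy => ?_
        rw [← eLpNorm_two_sq]
        refine ENNReal.rpow_le_rpow (h y fun hy0 => hy (by simp [hy0])) (by norm_num)
    _ = δ ^ (2 : ℝ) := by simp

/-- Mollification converges in `L²`. -/
theorem tendsto_eLpNorm_convolution_sub [CompleteSpace F] {φ : ℕ → ContDiffBump (0 : E k)}
    (hφ : Tendsto (fun n => (φ n).rOut) atTop (𝓝 0)) (v : Lp F 2 (volume : Measure (E k))) :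
    Tendsto (fun n => eLpNorm
      (fun x => ((φ n).normed volume ⋆[lsmul ℝ ℝ] v : E k → F) x - v x) 2 volume)
      atTop (𝓝 0) := by
  rw [ENNReal.tendsto_nhds_zero]
  intro δ hδ
  have h := ENNReal.tendsto_nhds_zero.1 (tendsto_eLpNorm_translate_sub v) δ hδ
  obtain ⟨r, hr, hball⟩ := Metric.eventually_nhds_iff_ball.1 h
  filter_upwards [hφ.eventually (gt_mem_nhds hr)] with n hn
  refine eLpNorm_convolution_sub_le (φ n).continuous_normed (φ n).hasCompactSupport_normed
    (φ n).nonneg_normed (φ n).integral_normed (Lp.stronglyMeasurable v) (locallyIntegrable_coe_Lp v)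
    fun y hy => hball y ?_
  have : y ∈ Function.support ((φ n).normed volume) := hy
  rw [ContDiffBump.support_normed_eq] at this
  exact Metric.ball_subset_ball hn.le this

theorem continuous_convolution {φ : ContDiffBump (0 : E k)} {v : E k → F}
    (hv : LocallyIntegrable v) : Continuous (φ.normed volume ⋆[lsmul ℝ ℝ] v : E k → F) :=
  (contDiff_convolution φ.contDiff_normed φ.hasCompactSupport_normed hv).continuous

/-- The averaging bound with the crude `δ = 2‖v‖` puts `ρ ⋆ v - v` in `L²`. -/
theorem memLp_convolution [CompleteSpace F] (φ : ContDiffBump (0 : E k))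
    (v : Lp F 2 (volume : Measure (E k))) :
    MemLp (φ.normed volume ⋆[lsmul ℝ ℝ] v : E k → F) 2 volume := by
  have hv := Lp.memLp v
  have hl := locallyIntegrable_coe_Lp v
  have h : MemLp (fun x => (φ.normed volume ⋆[lsmul ℝ ℝ] v : E k → F) x - v x) 2 volume := by
    refine ⟨(continuous_convolution hl).aestronglyMeasurable.sub hv.1,
      (eLpNorm_convolution_sub_le (δ := eLpNorm v 2 volume + eLpNorm v 2 volume)
        φ.continuous_normed φ.hasCompactSupport_normed φ.nonneg_normed φ.integral_normed
        (Lp.stronglyMeasurable v) hl fun y _ => ?_).trans_lt (ENNReal.add_lt_top.2 ⟨hv.2, hv.2⟩)⟩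
    have hm : MeasurePreserving (fun x : E k => x - y) volume volume :=
      measurePreserving_sub_right volume y
    refine (eLpNorm_sub_le (hv.1.comp_measurePreserving hm) hv.1 (by norm_num)).trans_eq ?_
    rw [eLpNorm_comp_measurePreserving hv.1 hm]
  exact (memLp_congr_ae (Eventually.of_forall fun x => sub_add_cancel _ _)).1 (h.add hv)

end Mollifier

/-! ### Continuity of weighted `L²` pairings. -/

section WeightedInner

open Filter Topology
open scoped ENNReal NNReal

variable {α F : Type*} [MeasurableSpace α] {μ : Measure α} [NormedAddCommGroup F]
  [InnerProductSpace ℝ F]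

theorem integrable_mul_inner {χ : α → ℝ} (hχ : AEStronglyMeasurable χ μ) {C : ℝ}
    (hC : ∀ x, ‖χ x‖ ≤ C) {f g : α → F} (hf : MemLp f 2 μ) (hg : MemLp g 2 μ) :
    Integrable (fun x => χ x * inner ℝ (f x) (g x)) μ := by
  have h := L2.integrable_inner (𝕜 := ℝ) (hf.toLp f) (hg.toLp g)
  have h' : Integrable (fun x => (inner ℝ (f x) (g x) : ℝ)) μ := by
    refine h.congr ?_
    filter_upwards [hf.coeFn_toLp, hg.coeFn_toLp] with x h₁ h₂
    rw [h₁, h₂]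
  exact h'.bdd_mul hχ (Eventually.of_forall hC)

theorem abs_integral_mul_inner_le {χ : α → ℝ} {C : ℝ} (hC : ∀ x, ‖χ x‖ ≤ C) {f g : α → F}
    (hf : MemLp f 2 μ) (hg : MemLp g 2 μ) :
    |∫ x, χ x * inner ℝ (f x) (g x) ∂μ| ≤ C * ((eLpNorm f 2 μ).toReal * (eLpNorm g 2 μ).toReal) := by
  rcases isEmpty_or_nonempty α with hα | ⟨⟨a⟩⟩
  -- On an empty space `hC` does not give `0 ≤ C`.
  · simp [μ.eq_zero_of_isEmpty]
  have hC0 : 0 ≤ C := (norm_nonneg _).trans (hC a)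
  have hint : Integrable (fun x => ‖f x‖ * ‖g x‖) μ := hf.norm.integrable_mul hg.norm
  rw [← Real.norm_eq_abs]
  calc ‖∫ x, χ x * inner ℝ (f x) (g x) ∂μ‖ ≤ ∫ x, C * (‖f x‖ * ‖g x‖) ∂μ := by
        refine norm_integral_le_of_norm_le (hint.const_mul C) (Eventually.of_forall fun x => ?_)
        rw [norm_mul]
        exact mul_le_mul (hC x) (norm_inner_le_norm _ _) (norm_nonneg _) hC0
    _ = C * ∫ x, ‖f x‖ * ‖g x‖ ∂μ := integral_const_mul _ _
    _ ≤ C * ((eLpNorm f 2 μ).toReal * (eLpNorm g 2 μ).toReal) := by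
        refine mul_le_mul_of_nonneg_left ?_ hC0
        have h : (inner ℝ (hf.norm.toLp _) (hg.norm.toLp _) : ℝ) = ∫ x, ‖f x‖ * ‖g x‖ ∂μ := by
          rw [L2.inner_def]
          refine integral_congr_ae ?_
          filter_upwards [hf.norm.coeFn_toLp, hg.norm.coeFn_toLp] with x h₁ h₂
          rw [h₁, h₂]
          exact mul_comm _ _
        rw [← h]
        refine (real_inner_le_norm _ _).trans_eq ?_
        rw [Lp.norm_toLp, Lp.norm_toLp, eLpNorm_norm, eLpNorm_norm]

theorem tendsto_integral_mul_inner {χ : α → ℝ} (hχ : AEStronglyMeasurable χ μ) {C : ℝ}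
    (hC : ∀ x, ‖χ x‖ ≤ C) {f g : ℕ → α → F} {f₀ g₀ : α → F} (hf : ∀ n, MemLp (f n) 2 μ)
    (hg : ∀ n, MemLp (g n) 2 μ) (hf₀ : MemLp f₀ 2 μ) (hg₀ : MemLp g₀ 2 μ)
    (hfl : Tendsto (fun n => eLpNorm (fun x => f n x - f₀ x) 2 μ) atTop (𝓝 0))
    (hgl : Tendsto (fun n => eLpNorm (fun x => g n x - g₀ x) 2 μ) atTop (𝓝 0)) :
    Tendsto (fun n => ∫ x, χ x * inner ℝ (f n x) (g n x) ∂μ) atTop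
      (𝓝 (∫ x, χ x * inner ℝ (f₀ x) (g₀ x) ∂μ)) := by
  set a : ℕ → ℝ := fun n => (eLpNorm (fun x => f n x - f₀ x) 2 μ).toReal
  set b : ℕ → ℝ := fun n => (eLpNorm (fun x => g n x - g₀ x) 2 μ).toReal
  have ha : Tendsto a atTop (𝓝 0) := (ENNReal.tendsto_toReal ENNReal.zero_ne_top).comp hfl
  have hb : Tendsto b atTop (𝓝 0) := (ENNReal.tendsto_toReal ENNReal.zero_ne_top).comp hgl
  have key (n : ℕ) : ‖(∫ x, χ x * inner ℝ (f n x) (g n x) ∂μ) -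
      ∫ x, χ x * inner ℝ (f₀ x) (g₀ x) ∂μ‖ ≤
      C * (a n * b n) + C * (a n * (eLpNorm g₀ 2 μ).toReal) +
        C * ((eLpNorm f₀ 2 μ).toReal * b n) := by
    have e : (∫ x, χ x * inner ℝ (f n x) (g n x) ∂μ) - ∫ x, χ x * inner ℝ (f₀ x) (g₀ x) ∂μ =
        (∫ x, χ x * inner ℝ (f n x - f₀ x) (g n x - g₀ x) ∂μ) +
        (∫ x, χ x * inner ℝ (f n x - f₀ x) (g₀ x) ∂μ) +
        ∫ x, χ x * inner ℝ (f₀ x) (g n x - g₀ x) ∂μ := by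
      have hfs := (hf n).sub hf₀
      have hgs := (hg n).sub hg₀
      have i₁ := integrable_mul_inner hχ hC hfs hgs
      have i₂ := integrable_mul_inner hχ hC hfs hg₀
      have i₃ := integrable_mul_inner hχ hC hf₀ hgs
      have h₁ := integral_add (i₁.add i₂) i₃
      have h₂ := integral_add i₁ i₂
      have h₃ := integral_sub (integrable_mul_inner hχ hC (hf n) (hg n))
        (integrable_mul_inner hχ hC hf₀ hg₀)
      simp only [Pi.add_apply, Pi.sub_apply] at h₁ h₂ h₃
      rw [← h₃, ← h₂, ← h₁]
      congr 1
      ext x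
      simp only [inner_sub_left, inner_sub_right]
      ring
    rw [e]
    refine (norm_add₃_le).trans ?_
    exact add_le_add (add_le_add
      (abs_integral_mul_inner_le hC ((hf n).sub hf₀) ((hg n).sub hg₀))
      (abs_integral_mul_inner_le hC ((hf n).sub hf₀) hg₀))
      (abs_integral_mul_inner_le hC hf₀ ((hg n).sub hg₀))
  rw [tendsto_iff_norm_sub_tendsto_zero]
  refine squeeze_zero (fun _ => norm_nonneg _) key ?_
  have := (((ha.mul hb).const_mul C).add ((ha.mul_const (eLpNorm g₀ 2 μ).toReal).const_mul C)).add
    ((hb.const_mul (eLpNorm f₀ 2 μ).toReal).const_mul C)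
  simpa using this

end WeightedInner

/-! ### Uniqueness of `L²` weak solutions. -/

section Uniqueness

open ContinuousLinearMap Convolution Filter Topology Laplacian Metric
open scoped ENNReal NNReal

variable {k d : ℕ}

/-- `v` solves `v - c Δ v + Nᵗ v = 0` in the sense of distributions. -/
def IsWeakSolution (c : ℝ) (N : E k → E d →L[ℝ] E d) (v : E k → E d) : Prop :=
  ∀ φ : E k → E d, ContDiff ℝ ∞ φ → HasCompactSupport φ →
    ∫ x, (inner ℝ (v x) (φ x) - c * inner ℝ (v x) (Δ φ x) + inner ℝ (v x) (N x (φ x))) = 0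

/-- `N` may be unbounded, so `Nᵗv` is only locally in `L²`; truncation to a ball makes the `L²`
mollification results applicable. -/
theorem memLp_indicator_adjoint_apply {N : E k → E d →L[ℝ] E d} (hN : Continuous N)
    (v : L2 k d) (R : ℝ) :
    MemLp ((closedBall (0 : E k) R).indicator fun x => adjoint (N x) (v x)) 2 volume := by
  have hN' : Continuous fun x => adjoint (N x) := (adjoint (𝕜 := ℝ)).continuous.comp hN
  obtain ⟨C, hC⟩ := (isCompact_closedBall (0 : E k) R).exists_bound_of_continuousOn
    hN'.continuousOn
  have hm : AEStronglyMeasurable (fun x => adjoint (N x) (v x)) volume :=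
    isBoundedBilinearMap_apply.continuous.comp_aestronglyMeasurable
      (hN'.aestronglyMeasurable.prodMk (Lp.aestronglyMeasurable v))
  refine (Lp.memLp v).of_le_mul (c := |C|) (hm.indicator isClosed_closedBall.measurableSet)
    (Eventually.of_forall fun x => ?_)
  by_cases hx : x ∈ closedBall (0 : E k) R
  · rw [Set.indicator_of_mem hx]
    exact le_of_opNorm_le _ ((hC x hx).trans (le_abs_self C)) _
  · rw [Set.indicator_of_notMem hx, norm_zero]
    positivity

/-- Test the equation with `y ↦ ρ(x - y) a` for arbitrary `a`. Since `ρ` lives in the unit ball and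
`‖x‖ ≤ R`, only `‖y‖ ≤ R + 1` matters, where `f` is `Nᵗv`. -/
theorem IsWeakSolution.laplacian_convolution_eq {c : ℝ} {N : E k → E d →L[ℝ] E d} {v : L2 k d}
    (hv : IsWeakSolution c N v) {R : ℝ} {f : L2 k d}
    (hf : f =ᵐ[volume] (closedBall (0 : E k) (R + 1)).indicator fun x => adjoint (N x) (v x))
    {ρ : E k → ℝ} (hρ : ContDiff ℝ ∞ ρ) (hc : HasCompactSupport ρ)
    (hρ1 : ∀ x, ρ x ≠ 0 → ‖x‖ ≤ 1) {x : E k} (hx : ‖x‖ ≤ R) :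
    c • Δ (ρ ⋆[lsmul ℝ ℝ] v : E k → E d) x =
      (ρ ⋆[lsmul ℝ ℝ] v : E k → E d) x + (ρ ⋆[lsmul ℝ ℝ] f : E k → E d) x := by
  refine ext_inner_left ℝ fun a => ?_
  have hlv := locallyIntegrable_coe_Lp v
  have hlf := locallyIntegrable_coe_Lp f
  have hcΔ := hasCompactSupport_laplacian hρ hc
  have i₁ := integrable_convolution_integrand hρ.continuous hc hlv x
  have i₂ := integrable_convolution_integrand (contDiff_laplacian hρ).continuous hcΔ hlv x
  have i₃ := integrable_convolution_integrand hρ.continuous hc hlf x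
  have hφ : ContDiff ℝ ∞ fun y => ρ (x - y) • a :=
    (hρ.comp (contDiff_const.sub contDiff_id)).smul contDiff_const
  have hφc : HasCompactSupport fun y => ρ (x - y) • a :=
    (hc.comp_homeomorph (Homeomorph.subLeft x)).smul_right
  have h := hv _ hφ hφc
  rw [inner_smul_right, inner_add_right, laplacian_convolution hρ hc hlv,
    convolution_lsmul_swap, convolution_lsmul_swap, ← integral_inner i₁, ← integral_inner i₂,
    ← integral_inner i₃]
  have e : ∫ y, (inner ℝ (v y) (ρ (x - y) • a) - c * inner ℝ (v y) (Δ (fun y => ρ (x - y) • a) y)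
        + inner ℝ (v y) (N y (ρ (x - y) • a))) =
      ∫ y, (inner ℝ a (ρ (x - y) • v y) - c * inner ℝ a (Δ ρ (x - y) • v y)
        + inner ℝ a (ρ (x - y) • f y)) := by
    refine integral_congr_ae ?_
    filter_upwards [hf] with y hy
    rw [laplacian_comp_sub_smul hρ, hy]
    simp only [inner_smul_right, map_smul, real_inner_comm a]
    congr 1
    by_cases hxy : ρ (x - y) = 0
    · simp [hxy]
    · have hy : y ∈ closedBall (0 : E k) (R + 1) := by
        rw [mem_closedBall_zero_iff]
        have h := norm_sub_le x (x - y)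
        rw [sub_sub_cancel] at h
        linarith [hρ1 _ hxy]
      rw [Set.indicator_of_mem hy, ← adjoint_inner_left, real_inner_comm]
  have j₁ : Integrable fun y => (inner ℝ a (ρ (x - y) • v y) : ℝ) := i₁.const_inner a
  have j₂ : Integrable fun y => c * (inner ℝ a (Δ ρ (x - y) • v y) : ℝ) :=
    (i₂.const_inner a).const_mul c
  have j₃ : Integrable fun y => (inner ℝ a (ρ (x - y) • f y) : ℝ) := i₃.const_inner a
  have j₁₂ : Integrable fun y =>
      (inner ℝ a (ρ (x - y) • v y) - c * inner ℝ a (Δ ρ (x - y) • v y) : ℝ) := j₁.sub j₂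
  rw [e, integral_add j₁₂ j₃, integral_sub j₁ j₂, integral_const_mul] at h
  linarith

/-- The localized energy inequality. -/
theorem IsWeakSolution.integral_cutoff_le {c : ℝ} (hc0 : 0 ≤ c) {N : E k → E d →L[ℝ] E d}
    (hN : Continuous N) (hpos : ∀ x w, 0 ≤ inner ℝ w (N x w)) {v : L2 k d}
    (hv : IsWeakSolution c N v) {χ : E k → ℝ} (hχ : ContDiff ℝ ∞ χ) (hc : HasCompactSupport χ)
    (hχ0 : ∀ x, 0 ≤ χ x) :
    ∫ x, χ x * inner ℝ (v x) (v x) ≤ c / 2 * ∫ x, Δ χ x * inner ℝ (v x) (v x) := by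
  obtain ⟨R, hR⟩ : ∃ R : ℝ, ∀ x, χ x ≠ 0 → ‖x‖ ≤ R := by
    obtain ⟨R, hR⟩ := hc.isCompact.isBounded.subset_closedBall 0
    exact ⟨R, fun x hx => mem_closedBall_zero_iff.1 (hR (subset_tsupport _ hx))⟩
  have hfm := memLp_indicator_adjoint_apply hN v (R + 1)
  set f : L2 k d := hfm.toLp _
  have hf : f =ᵐ[volume] _ := hfm.coeFn_toLp
  -- Outer radius `1/(n+1) ≤ 1` keeps each mollifier in the unit ball, as the truncation at `R + 1`
  -- requires.
  let φ : ℕ → ContDiffBump (0 : E k) := fun n =>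
    ⟨1 / (2 * ((n : ℝ) + 1)), 1 / ((n : ℝ) + 1), by positivity,
      one_div_lt_one_div_of_lt (by positivity) (by linarith [n.cast_nonneg (α := ℝ)])⟩
  have hφ : Tendsto (fun n => (φ n).rOut) atTop (𝓝 0) := tendsto_one_div_add_atTop_nhds_zero_nat
  let w : ℕ → E k → E d := fun n => (φ n).normed volume ⋆[lsmul ℝ ℝ] v
  let h : ℕ → E k → E d := fun n => (φ n).normed volume ⋆[lsmul ℝ ℝ] f
  have hwl : Tendsto (fun n => eLpNorm (fun x => w n x - v x) 2 volume) atTop (𝓝 0) :=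
    tendsto_eLpNorm_convolution_sub hφ v
  have hhl : Tendsto (fun n => eLpNorm (fun x => h n x - f x) 2 volume) atTop (𝓝 0) :=
    tendsto_eLpNorm_convolution_sub hφ f
  have hws (n : ℕ) : ContDiff ℝ ∞ (w n) := contDiff_convolution (φ n).contDiff_normed
    (φ n).hasCompactSupport_normed (locallyIntegrable_coe_Lp v)
  have hhs (n : ℕ) : ContDiff ℝ ∞ (h n) := contDiff_convolution (φ n).contDiff_normed
    (φ n).hasCompactSupport_normed (locallyIntegrable_coe_Lp f)
  have hχΔ := contDiff_laplacian hχ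
  have hcΔ := hasCompactSupport_laplacian hχ hc
  obtain ⟨C, hC⟩ := hχ.continuous.bounded_above_of_compact_support hc
  obtain ⟨C', hC'⟩ := hχΔ.continuous.bounded_above_of_compact_support hcΔ
  have key (n : ℕ) : (∫ x, χ x * inner ℝ (w n x) (w n x)) + ∫ x, χ x * inner ℝ (w n x) (h n x) ≤
      c / 2 * ∫ x, Δ χ x * inner ℝ (w n x) (w n x) := by
    have hρ1 (x : E k) (hx : (φ n).normed volume x ≠ 0) : ‖x‖ ≤ 1 := by
      have : x ∈ Function.support ((φ n).normed volume) := hx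
      rw [ContDiffBump.support_normed_eq, mem_ball_zero_iff] at this
      refine this.le.trans ?_
      change 1 / ((n : ℝ) + 1) ≤ 1
      rw [div_le_one (by positivity)]
      linarith [n.cast_nonneg (α := ℝ)]
    have hint {g : E k → ℝ} (hg : Continuous g) : Integrable fun x => χ x * g x :=
      (hχ.continuous.mul hg).integrable_of_hasCompactSupport hc.mul_right
    have hww : ContDiff ℝ ∞ fun x => (inner ℝ (w n x) (w n x) : ℝ) := (hws n).inner ℝ (hws n)
    -- Moving the Laplacian onto `χ` leaves no derivative of `w n`, so both sides pass to the `L²`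
    -- limit.
    have hL := integral_bilin_laplacian hχ hww hc (ContinuousLinearMap.mul ℝ ℝ)
    simp only [ContinuousLinearMap.mul_apply'] at hL
    rw [← hL, ← integral_add (hint ((hws n).continuous.inner (hws n).continuous))
      (hint ((hws n).continuous.inner (hhs n).continuous)), ← integral_const_mul]
    refine integral_mono ((hint ((hws n).continuous.inner (hws n).continuous)).add
      (hint ((hws n).continuous.inner (hhs n).continuous)))
      ((hint (contDiff_laplacian hww).continuous).const_mul _) fun x => ?_
    by_cases hx : χ x = 0
    · simp [hx]
    have he := hv.laplacian_convolution_eq (R := R) hf (φ n).contDiff_normed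
      (φ n).hasCompactSupport_normed hρ1 (hR x hx)
    change c • Δ (w n) x = w n x + h n x at he
    have h2 := two_mul_inner_laplacian_le (hws n) x
    simp only
    rw [← mul_add, ← inner_add_right, ← he, inner_smul_right]
    have := mul_le_mul_of_nonneg_left h2 (mul_nonneg hc0 (hχ0 x))
    linarith
  have hwm (n : ℕ) : MemLp (w n) 2 volume := memLp_convolution (φ n) v
  have hhm (n : ℕ) : MemLp (h n) 2 volume := memLp_convolution (φ n) f
  have hvm := Lp.memLp v
  have hlim := le_of_tendsto_of_tendsto'
    ((tendsto_integral_mul_inner hχ.continuous.aestronglyMeasurable hC hwm hwm hvm hvm hwl hwl).add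
      (tendsto_integral_mul_inner hχ.continuous.aestronglyMeasurable hC hwm hhm hvm (Lp.memLp f)
        hwl hhl))
    ((tendsto_integral_mul_inner hχΔ.continuous.aestronglyMeasurable hC' hwm hwm hvm hvm
      hwl hwl).const_mul (c / 2)) key
  -- In the limit the zeroth-order term is `χ⟨Nv, v⟩` on the ball and zero outside it.
  have hfpos : 0 ≤ ∫ x, χ x * inner ℝ (v x) (f x) := by
    refine integral_nonneg_of_ae ?_
    filter_upwards [hf] with x hx
    rw [hx]
    refine mul_nonneg (hχ0 x) ?_
    by_cases hxR : x ∈ closedBall (0 : E k) (R + 1)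
    · rw [Set.indicator_of_mem hxR, adjoint_inner_right, real_inner_comm]
      exact hpos x _
    · rw [Set.indicator_of_notMem hxR, inner_zero_right]
  linarith

/-- Apply the energy inequality to `χ(r·)` with `r → 0`: the left side tends to `‖v‖²` by dominated
convergence, while `Δ(χ(r·))` is `O(r²)` uniformly. -/
theorem IsWeakSolution.eq_zero {c : ℝ} (hc0 : 0 ≤ c) {N : E k → E d →L[ℝ] E d}
    (hN : Continuous N) (hpos : ∀ x w, 0 ≤ inner ℝ w (N x w)) {v : L2 k d}
    (hv : IsWeakSolution c N v) : v = 0 := by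
  let χ : ContDiffBump (0 : E k) := ⟨1, 2, one_pos, one_lt_two⟩
  have hχ : ContDiff ℝ ∞ χ := χ.contDiff
  obtain ⟨C, hC⟩ := (contDiff_laplacian hχ).continuous.bounded_above_of_compact_support
    (hasCompactSupport_laplacian hχ χ.hasCompactSupport)
  let r : ℕ → ℝ := fun n => 1 / ((n : ℝ) + 1)
  have hr0 (n : ℕ) : r n ≠ 0 := by simp only [r]; positivity
  have hr : Tendsto r atTop (𝓝 0) := tendsto_one_div_add_atTop_nhds_zero_nat
  have hvv : Integrable fun x => (inner ℝ (v x) (v x) : ℝ) := L2.integrable_inner v v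
  have key (n : ℕ) : ∫ x, χ (r n • x) * inner ℝ (v x) (v x) ≤
      c / 2 * (r n ^ 2 * C * ∫ x, (inner ℝ (v x) (v x) : ℝ)) := by
    have hs : ContDiff ℝ ∞ fun x => χ (r n • x) := hχ.comp (contDiff_id.const_smul (r n))
    have hcs : HasCompactSupport fun x => χ (r n • x) :=
      χ.hasCompactSupport.comp_homeomorph (Homeomorph.smulOfNeZero (r n) (hr0 n))
    refine (hv.integral_cutoff_le hc0 hN hpos hs hcs fun x => χ.nonneg).trans ?_
    refine mul_le_mul_of_nonneg_left ?_ (by positivity)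
    rw [laplacian_comp_const_smul hχ, ← integral_const_mul]
    have hb (x : E k) : ‖r n ^ 2 • Δ (χ : E k → ℝ) (r n • x)‖ ≤ r n ^ 2 * C := by
      rw [norm_smul, Real.norm_of_nonneg (sq_nonneg _)]
      exact mul_le_mul_of_nonneg_left (hC _) (sq_nonneg _)
    refine integral_mono (hvv.bdd_mul (c := r n ^ 2 * C) ?_ (Eventually.of_forall hb))
      (hvv.const_mul _) fun x => ?_
    · exact (((contDiff_laplacian hχ).continuous.comp (continuous_const_smul _)).const_smul
        (r n ^ 2)).aestronglyMeasurable
    · exact mul_le_mul_of_nonneg_right ((Real.le_norm_self _).trans (hb x)) real_inner_self_nonneg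
  have hlim : Tendsto (fun n => ∫ x, χ (r n • x) * inner ℝ (v x) (v x)) atTop
      (𝓝 (∫ x, (inner ℝ (v x) (v x) : ℝ))) := by
    refine tendsto_integral_of_dominated_convergence (fun x => inner ℝ (v x) (v x)) (fun n => ?_)
      hvv (fun n => Eventually.of_forall fun x => ?_) (Eventually.of_forall fun x => ?_)
    · exact (χ.continuous.comp (continuous_const_smul (r n))).aestronglyMeasurable.mul
        hvv.aestronglyMeasurable
    · rw [norm_mul, Real.norm_of_nonneg χ.nonneg, Real.norm_of_nonneg real_inner_self_nonneg]
      exact mul_le_of_le_one_left real_inner_self_nonneg χ.le_one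
    · have h1 : Tendsto (fun n => χ (r n • x)) atTop (𝓝 (χ ((0 : ℝ) • x))) :=
        (χ.continuous.tendsto _).comp (hr.smul_const x)
      rw [zero_smul, χ.one_of_mem_closedBall (mem_closedBall_self χ.rIn_pos.le)] at h1
      simpa using h1.mul_const (inner ℝ (v x) (v x) : ℝ)
  have hle := le_of_tendsto_of_tendsto' hlim
    ((((hr.pow 2).mul_const C).mul_const (∫ x, (inner ℝ (v x) (v x) : ℝ))).const_mul (c / 2)) key
  rw [← L2.inner_def, real_inner_self_eq_norm_sq] at hle
  have : ‖v‖ ^ 2 ≤ 0 := by simpa using hle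
  exact norm_eq_zero.1 (pow_eq_zero_iff two_ne_zero |>.1 (le_antisymm this (sq_nonneg _)))

end Uniqueness

/-! ### Operators `-cΔ + N` on test functions. -/

section TestOperators

open Filter Topology Laplacian

variable {k d : ℕ}

theorem coeFn_testToL2 (φ : Test k (E d)) : testToL2 k d φ =ᵐ[volume] φ :=
  (φ.continuous.memLp_of_hasCompactSupport φ.hasCompactSupport).coeFn_toLp

theorem inner_testToL2_right (v : L2 k d) (φ : Test k (E d)) :
    inner ℝ v (testToL2 k d φ) = ∫ x, (inner ℝ (v x) (φ x) : ℝ) := by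
  rw [L2.inner_def]
  refine integral_congr_ae ?_
  filter_upwards [coeFn_testToL2 φ] with x hx
  rw [hx]

theorem inner_testToL2_testToL2 (φ ψ : Test k (E d)) :
    inner ℝ (testToL2 k d φ) (testToL2 k d ψ) = ∫ x, (inner ℝ (φ x) (ψ x) : ℝ) := by
  rw [inner_testToL2_right]
  refine integral_congr_ae ?_
  filter_upwards [coeFn_testToL2 φ] with x hx
  rw [hx]

/-- A smooth compactly supported function as a test function. -/
def mkTest {F : Type} [NormedAddCommGroup F] [NormedSpace ℝ F] (φ : E k → F)
    (hφ : ContDiff ℝ ∞ φ) (hc : HasCompactSupport φ) : Test k F where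
  toFun := φ
  contDiff' := hφ
  hasCompactSupport' := hc
  tsupport_subset' := fun _ _ => trivial

theorem dense_range_testToL2 : Dense (LinearMap.range (testToL2 k d) : Set (L2 k d)) := by
  rw [Submodule.dense_iff_topologicalClosure_eq_top, Submodule.topologicalClosure_eq_top_iff,
    Submodule.eq_bot_iff]
  intro v hv
  -- With `c = 0` and `N = 0`, a weak solution is exactly a vector orthogonal to all test functions.
  refine IsWeakSolution.eq_zero (N := 0) le_rfl continuous_const (by simp) fun φ hφ hc => ?_
  have h := (Submodule.mem_orthogonal' _ _).1 hv _ ⟨mkTest φ hφ hc, rfl⟩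
  rw [inner_testToL2_right] at h
  simpa using! h

/-- The partial derivative of a test function. -/
def testPDeriv (i : Fin k) : Test k (E d) →ₗ[ℝ] Test k (E d) where
  toFun φ := mkTest (pderiv i φ) (contDiff_pderiv φ.contDiff i)
    (hasCompactSupport_pderiv φ.hasCompactSupport i)
  map_add' φ ψ := by
    ext1 x
    exact pderiv_eq ((hasFDerivAt_of_contDiff φ.contDiff x).add
      (hasFDerivAt_of_contDiff ψ.contDiff x)) i
  map_smul' c φ := by
    ext1 x
    exact pderiv_eq ((hasFDerivAt_of_contDiff φ.contDiff x).const_smul c) i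

/-- The vector-valued test function `ψ a`. -/
def testSMulConst (ψ : Test k ℝ) (a : E d) : Test k (E d) :=
  mkTest (fun x => ψ x • a) (ψ.contDiff.smul contDiff_const) ψ.hasCompactSupport.smul_right

theorem inner_testPDeriv (i : Fin k) (φ ψ : Test k (E d)) :
    inner ℝ (testToL2 k d ψ) (testToL2 k d (testPDeriv i φ)) =
      - inner ℝ (testToL2 k d (testPDeriv i ψ)) (testToL2 k d φ) := by
  rw [inner_testToL2_testToL2, inner_testToL2_testToL2]
  exact integral_bilin_pderiv ψ.contDiff φ.contDiff ψ.hasCompactSupport (innerSL ℝ) i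

theorem inner_integral_test_smul (a : E d) (ψ : Test k ℝ) (u : L2 k d) :
    inner ℝ a (∫ x, ψ x • u x) = inner ℝ (testToL2 k d (testSMulConst ψ a)) u := by
  have hi : Integrable fun x => ψ x • u x :=
    (locallyIntegrable_coe_Lp u).integrable_smul_left_of_hasCompactSupport ψ.continuous
      ψ.hasCompactSupport
  rw [real_inner_comm u, inner_testToL2_right, ← integral_inner hi]
  refine integral_congr_ae (Eventually.of_forall fun x => ?_)
  change _ = inner ℝ (u x) (ψ x • a)
  simp only
  rw [inner_smul_right, inner_smul_right, real_inner_comm]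

variable {A : Test k (E d) →ₗ[ℝ] Test k (E d)} {c : ℝ} {N : E k → E d →L[ℝ] E d}

theorem inner_apply_self_eq (hN : Continuous N)
    (hA : ∀ φ x, A φ x = -(c • Δ (φ : E k → E d) x) + N x (φ x))
    (φ : Test k (E d)) : inner ℝ (testToL2 k d (A φ)) (testToL2 k d φ) =
      c * ∑ i, ‖testToL2 k d (testPDeriv i φ)‖ ^ 2 + ∫ x, (inner ℝ (φ x) (N x (φ x)) : ℝ) := by
  have hφ : ContDiff ℝ ∞ φ := φ.contDiff
  have hΔ := contDiff_laplacian hφ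
  rw [real_inner_comm, inner_testToL2_testToL2]
  simp_rw [hA, inner_add_right, inner_neg_right, inner_smul_right]
  have i₁ : Integrable fun x => (inner ℝ (φ x) (Δ (φ : E k → E d) x) : ℝ) :=
    integrable_bilin hφ.continuous hΔ.continuous φ.hasCompactSupport (innerSL ℝ)
  have i₂ : Integrable fun x => (inner ℝ (φ x) (N x (φ x)) : ℝ) :=
    integrable_bilin hφ.continuous (hN.clm_apply hφ.continuous) φ.hasCompactSupport (innerSL ℝ)
  have i₃ : Integrable fun x => -(c * (inner ℝ (φ x) (Δ (φ : E k → E d) x) : ℝ)) :=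
    (i₁.const_mul c).neg
  rw [integral_add i₃ i₂, integral_neg, integral_const_mul]
  have h : ∫ x, (inner ℝ (φ x) (Δ (φ : E k → E d) x) : ℝ) = _ :=
    integral_bilin_laplacian_eq_neg_sum hφ hφ φ.hasCompactSupport (innerSL ℝ)
  rw [h, mul_neg, neg_neg]
  congr 2
  refine Finset.sum_congr rfl fun i _ => ?_
  rw [← real_inner_self_eq_norm_sq, inner_testToL2_testToL2]
  rfl

/-- The energy estimate behind both accretivity and the `H¹` regularity. -/
theorem mul_sum_norm_sq_testPDeriv_le (hN : Continuous N) (hpos : ∀ x w, 0 ≤ inner ℝ w (N x w))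
    (hA : ∀ φ x, A φ x = -(c • Δ (φ : E k → E d) x) + N x (φ x)) (φ : Test k (E d)) :
    c * ∑ i, ‖testToL2 k d (testPDeriv i φ)‖ ^ 2 ≤
      inner ℝ (testToL2 k d (A φ)) (testToL2 k d φ) := by
  rw [inner_apply_self_eq hN hA]
  exact le_add_of_nonneg_right (integral_nonneg fun x => hpos x _)

theorem isAccretive_toUnbounded (hc : 0 ≤ c) (hN : Continuous N)
    (hpos : ∀ x w, 0 ≤ inner ℝ w (N x w))
    (hA : ∀ φ x, A φ x = -(c • Δ (φ : E k → E d) x) + N x (φ x)) :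
    IsAccretive (toUnbounded A) := by
  rintro ⟨_, φ, rfl⟩
  rw [toUnbounded_apply]
  exact le_trans (by positivity) (mul_sum_norm_sq_testPDeriv_le hN hpos hA φ)

theorem eq_zero_of_inner_add_toUnbounded (hc : 0 ≤ c) (hN : Continuous N)
    (hpos : ∀ x w, 0 ≤ inner ℝ w (N x w))
    (hA : ∀ φ x, A φ x = -(c • Δ (φ : E k → E d) x) + N x (φ x))
    {v : L2 k d} (hv : ∀ u : (toUnbounded A).domain, inner ℝ v ((u : L2 k d) + toUnbounded A u) = 0) :
    v = 0 := by
  refine IsWeakSolution.eq_zero hc hN hpos fun φ hφ hφc => ?_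
  have h := hv ⟨testToL2 k d (mkTest φ hφ hφc), LinearMap.mem_range_self _ _⟩
  rw [toUnbounded_apply, ← map_add, inner_testToL2_right] at h
  rw [← h]
  refine integral_congr_ae (Eventually.of_forall fun x => ?_)
  change _ = inner ℝ (v x) (φ x + A (mkTest φ hφ hφc) x)
  rw [hA, inner_add_right, inner_add_right, inner_neg_right, inner_smul_right]
  change _ = inner ℝ (v x) (φ x) + (-(c * inner ℝ (v x) (Δ φ x)) + inner ℝ (v x) (N x (φ x)))
  ring

theorem isClosable_toUnbounded (hc : 0 ≤ c) (hN : Continuous N)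
    (hpos : ∀ x w, 0 ≤ inner ℝ w (N x w))
    (hA : ∀ φ x, A φ x = -(c • Δ (φ : E k → E d) x) + N x (φ x)) :
    (toUnbounded A).IsClosable :=
  (isAccretive_toUnbounded hc hN hpos hA).isClosable dense_range_testToL2

theorem isMaximallyAccretive_closure_toUnbounded (hc : 0 ≤ c) (hN : Continuous N)
    (hpos : ∀ x w, 0 ≤ inner ℝ w (N x w))
    (hA : ∀ φ x, A φ x = -(c • Δ (φ : E k → E d) x) + N x (φ x)) :
    IsMaximallyAccretive (toUnbounded A).closure :=
  (isAccretive_toUnbounded hc hN hpos hA).isMaximallyAccretive_closure dense_range_testToL2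
    fun _ hv => eq_zero_of_inner_add_toUnbounded hc hN hpos hA hv

/-- Applied to differences, the energy estimate makes `∂ᵢφₙ` Cauchy whenever `(φₙ, Aφₙ)` converges;
the limit is the weak derivative by integration by parts. Here `c > 0` is essential. -/
theorem memH1_of_mem_closure_domain (hc : 0 < c) (hN : Continuous N)
    (hpos : ∀ x w, 0 ≤ inner ℝ w (N x w))
    (hA : ∀ φ x, A φ x = -(c • Δ (φ : E k → E d) x) + N x (φ x))
    {u : L2 k d} (hu : u ∈ (toUnbounded A).closure.domain) : MemH1 u := by
  have hmem := (toUnbounded A).closure.mem_graph ⟨u, hu⟩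
  rw [← (isClosable_toUnbounded hc.le hN hpos hA).graph_closure_eq_closure_graph] at hmem
  obtain ⟨p, hp, hpl⟩ := mem_closure_iff_seq_limit.1 hmem
  have hφ (n : ℕ) : ∃ φ : Test k (E d), (testToL2 k d φ, testToL2 k d (A φ)) = p n := by
    obtain ⟨⟨_, φ, rfl⟩, h₁, h₂⟩ := LinearPMap.mem_graph_iff (f := toUnbounded A) |>.1 (hp n)
    rw [toUnbounded_apply] at h₂
    exact ⟨φ, Prod.ext h₁ h₂⟩
  choose φ hφ using hφ
  have hul : Tendsto (fun n => testToL2 k d (φ n)) atTop (𝓝 u) := by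
    refine ((continuous_fst.tendsto _).comp hpl).congr fun n => ?_
    simp [← hφ]
  intro i
  have hd (m n : ℕ) : dist (testToL2 k d (testPDeriv i (φ m)))
      (testToL2 k d (testPDeriv i (φ n))) ≤ (√c)⁻¹ * dist (p m) (p n) := by
    rw [dist_eq_norm, dist_eq_norm, ← map_sub, ← map_sub, le_inv_mul_iff₀ (Real.sqrt_pos.2 hc)]
    refine le_of_sq_le_sq ?_ (norm_nonneg _)
    rw [mul_pow, Real.sq_sqrt hc.le]
    have hp' : p m - p n = (testToL2 k d (φ m - φ n), testToL2 k d (A (φ m - φ n))) := by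
      rw [← hφ, ← hφ, Prod.mk_sub_mk, map_sub, map_sub, map_sub]
    have h₁ : ‖testToL2 k d (φ m - φ n)‖ ≤ ‖p m - p n‖ := by rw [hp']; exact le_max_left _ _
    have h₂ : ‖testToL2 k d (A (φ m - φ n))‖ ≤ ‖p m - p n‖ := by rw [hp']; exact le_max_right _ _
    calc c * ‖testToL2 k d (testPDeriv i (φ m - φ n))‖ ^ 2
        ≤ c * ∑ j, ‖testToL2 k d (testPDeriv j (φ m - φ n))‖ ^ 2 := by
          refine mul_le_mul_of_nonneg_left ?_ hc.le
          exact Finset.single_le_sum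
            (f := fun j => ‖testToL2 k d (testPDeriv j (φ m - φ n))‖ ^ 2)
            (fun _ _ => sq_nonneg _) (Finset.mem_univ i)
      _ ≤ ‖testToL2 k d (A (φ m - φ n))‖ * ‖testToL2 k d (φ m - φ n)‖ :=
          (mul_sum_norm_sq_testPDeriv_le hN hpos hA _).trans (real_inner_le_norm _ _)
      _ ≤ ‖p m - p n‖ * ‖p m - p n‖ := mul_le_mul h₂ h₁ (norm_nonneg _) (norm_nonneg _)
      _ = ‖p m - p n‖ ^ 2 := (sq _).symm
  have hcau : CauchySeq fun n => testToL2 k d (testPDeriv i (φ n)) := by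
    rw [Metric.cauchySeq_iff]
    intro ε hε
    obtain ⟨n₀, h₀⟩ := Metric.cauchySeq_iff.1 hpl.cauchySeq (√c * ε)
      (mul_pos (Real.sqrt_pos.2 hc) hε)
    refine ⟨n₀, fun m hm n hn => (hd m n).trans_lt ?_⟩
    rw [inv_mul_lt_iff₀ (Real.sqrt_pos.2 hc)]
    exact h₀ m hm n hn
  obtain ⟨g, hg⟩ := cauchySeq_tendsto_of_complete hcau
  -- Pairing with a constant vector `a` turns the vector-valued integrals into `L²` inner products
  -- with the test function `ψ a`.
  refine ⟨g, fun ψ => ext_inner_left ℝ fun a => ?_⟩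
  let ψ' : Test k ℝ := mkTest (pderiv i ψ) (contDiff_pderiv ψ.contDiff i)
    (hasCompactSupport_pderiv ψ.hasCompactSupport i)
  have hψ : testPDeriv i (testSMulConst ψ a) = testSMulConst ψ' a := by
    ext1 x
    exact pderiv_eq ((hasFDerivAt_of_contDiff ψ.contDiff x).smul_const a) i
  rw [inner_neg_right, inner_integral_test_smul]
  change _ = -(inner ℝ a (∫ x, ψ' x • u x))
  rw [inner_integral_test_smul, ← hψ]
  refine tendsto_nhds_unique (tendsto_const_nhds.inner hg)
    ((tendsto_const_nhds.inner hul).neg.congr fun n => ?_)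
  exact (inner_testPDeriv i (φ n) _).symm

end TestOperators

/-- The antisymmetric part of `B` contributes nothing to `⟨w, Bw⟩`. -/
theorem inner_toEuclideanCLM_nonneg {d : ℕ} {B : Matrix (Fin d) (Fin d) ℝ}
    (hB : ((1 / 2 : ℝ) • (B + Bᵀ)).PosSemidef) (w : E d) :
    0 ≤ inner ℝ w (Matrix.toEuclideanCLM (𝕜 := ℝ) B w) := by
  have h := hB.dotProduct_mulVec_nonneg w.ofLp
  rw [Matrix.smul_mulVec, dotProduct_smul, Matrix.add_mulVec, dotProduct_add,
    Matrix.mulVec_transpose, star_trivial, dotProduct_comm w.ofLp (w.ofLp ᵥ* B),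
    ← Matrix.dotProduct_mulVec, smul_eq_mul] at h
  rw [Matrix.inner_toEuclideanCLM]
  linarith

theorem continuous_toEuclideanCLM_comp {X : Type*} [TopologicalSpace X] {d : ℕ}
    {M : X → Matrix (Fin d) (Fin d) ℝ} (hM : ∀ i j, Continuous fun x => M x i j) :
    Continuous fun x => Matrix.toEuclideanCLM (𝕜 := ℝ) (M x) :=
  (LinearMap.continuous_of_finiteDimensional
    (Matrix.toEuclideanCLM (n := Fin d) (𝕜 := ℝ) :
      Matrix (Fin d) (Fin d) ℝ →ₗ[ℝ] E d →L[ℝ] E d)).comp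
    (continuous_matrix hM)

end BlochTorrey

end

theorem proposition2p1 :
    (∀ (k d : ℕ) (M : BlochTorrey.E k → Matrix (Fin d) (Fin d) ℝ)
      (hM : ∀ i j, ContDiff ℝ ∞ fun x => M x i j),
      (∀ x, ((1 / 2 : ℝ) • (M x + (M x)ᵀ)).PosSemidef) →
        (BlochTorrey.schrodingerOp M hM).IsClosable ∧
        BlochTorrey.IsMaximallyAccretive (BlochTorrey.schrodingerOp M hM).closure ∧
        ∀ u ∈ (BlochTorrey.schrodingerOp M hM).closure.domain, BlochTorrey.MemH1 u) ∧
    (∀ (ε : ℝ) (b : BlochTorrey.E 3 → BlochTorrey.E 3) (hb : ContDiff ℝ ∞ b), 0 < ε →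
      (BlochTorrey.blochTorreyOp ε b hb).IsClosable ∧
      BlochTorrey.IsMaximallyAccretive (BlochTorrey.blochTorreyOp ε b hb).closure) := by
  open BlochTorrey Laplacian in
  constructor
  · intro k d M hM hpos
    have hN := continuous_toEuclideanCLM_comp fun i j => (hM i j).continuous
    have hp (x : E k) (w : E d) := inner_toEuclideanCLM_nonneg (hpos x) w
    have hA (φ : Test k (E d)) (x : E k) : (-testLaplacian k d + testMulVec M hM) φ x =
        -((1 : ℝ) • Δ (φ : E k → E d) x) + Matrix.toEuclideanCLM (𝕜 := ℝ) (M x) (φ x) := by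
      rw [one_smul]
      rfl
    exact ⟨isClosable_toUnbounded zero_le_one hN hp hA,
      isMaximallyAccretive_closure_toUnbounded zero_le_one hN hp hA,
      fun u hu => memH1_of_mem_closure_domain one_pos hN hp hA hu⟩
  · intro ε b hb hε
    -- The cross product as a matrix field; positivity holds with equality, since `w · (b × w) = 0`.
    let B : E 3 → Matrix (Fin 3) (Fin 3) ℝ := fun x => LinearMap.toMatrix' (crossProduct (b x).ofLp)
    have hBv (x : E 3) (w : Fin 3 → ℝ) : B x *ᵥ w = (b x).ofLp ⨯₃ w :=
      LinearMap.toMatrix'_mulVec _ _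
    have hB (i j : Fin 3) : Continuous fun x => B x i j := by
      have hc (l : Fin 3) : Continuous fun x => b x l :=
        (contDiff_euclidean.1 hb l).continuous
      simp only [B, LinearMap.toMatrix'_apply, cross_apply]
      fin_cases i <;> simp <;> fun_prop
    have hN := continuous_toEuclideanCLM_comp hB
    have hp (x w : E 3) : 0 ≤ inner ℝ w (Matrix.toEuclideanCLM (𝕜 := ℝ) (B x) w) := by
      rw [Matrix.inner_toEuclideanCLM, hBv, dot_cross_self]
    have hA (φ : Test 3 (E 3)) (x : E 3) :
        (-(ε ^ 2 • testLaplacian 3 3) + testCross b hb) φ x =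
          -(ε ^ 2 • Δ (φ : E 3 → E 3) x) + Matrix.toEuclideanCLM (𝕜 := ℝ) (B x) (φ x) := by
      have : Matrix.toEuclideanCLM (𝕜 := ℝ) (B x) (φ x) =
          WithLp.toLp 2 ((b x).ofLp ⨯₃ (φ x).ofLp) := by
        rw [← hBv]
        rfl
      rw [this]
      rfl
    exact ⟨isClosable_toUnbounded (sq_nonneg ε) hN hp hA,
      isMaximallyAccretive_closure_toUnbounded (sq_nonneg ε) hN hp hA⟩
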